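/- Let $\mathbb H$ be the real quaternions, written $a=[a_0,\vec a]$ with $a_0\in\mathbb R$, $\vec a\in\mathbb R^3$, with conjugate $a^*=[a_0,-\vec a]$ and cross product $a\times b=[0,\;a_0\vec b+b_0\vec a+\vec a\times\vec b]$. Let $\mathbb D=\{a_r+\epsilon a_d : a_r,a_d\in\mathbb H\}$, $\epsilon^2=0$, be the dual quaternions, with conjugate $\hat a^*=a_r^*+\epsilon a_d^*$ and cross product $\hat a\times\hat b=a_r\times b_r+\epsilon(a_d\times b_r+a_r\times b_d)$. Let $\mathbb D_u=\{\hat a:\hat a^*\hat a=\hat a\hat a^*=\hat a\cdot\hat a=1\}$, where $\hat a\cdot\hat a=\|a_r\|^2+2\epsilon\langle a_r,a_d\rangle$, be the unit dual quaternions, and let $\mathbb D_v$ be the vector dual quaternions (both parts have zero scalar component). Consider the relative pose/velocity system of a target frame $T$ with respect to a camera frame $C$, with state $x=(\hat q,\hat\omega)\in\mathbb D_u\times\mathbb D_v$, $$\dot{\hat q}=\tfrac12\,\hat\omega\,\hat q,\qquad \dot{\hat\omega}=\hat q\,\hat\alpha_T\,\hat q^*+\hat\omega\times\hat\omega_C-\hat\alpha_C,$$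 where the inertial dual acceleration $\hat\alpha_T$ of the target and the inertial dual velocity $\hat\omega_C$ and dual acceleration $\hat\alpha_C$ of the camera are arbitrary $\mathbb D_v$-valued functions of the state and the control (no model of the forces and torques is assumed), and the set of admissible control signals is non-empty. Write $\hat q=q+\epsilon\mu$ and $\hat\omega=\omega+\epsilon\beta$; then $\mu=\tfrac12 r q$, where $r=2\mu q^*$ is the position of $T$ relative to $C$ in $C$ coordinates. Three markers with known positions $p_1,p_2,p_3\in\mathbb R^3$ in the target frame are measured through $$h(x)=(y_1,y_2,y_3),\qquad y_i=2\mu q^*+q\,[0,p_i]\,q^*\in\mathbb H .$$ Suppose that the markers are not collinear: $[0,p_2-p_1]\times[0,p_3-p_1]\neq 0$. Then: 1. In the transformed coordinates $\bar x=(q,\mu,\omega,\beta)\in\mathbb H^4\cong\mathbb R^{16}$, the $24\times16$ observability codistribution matrix, formed by the Jacobians with respect to $\bar x$ of the zeroth- and first-order Lie derivatives $\mathcal L_f^0h=h$ and $\mathcal L_f^1h=\nabla h\cdot f$ of the measurement function along the system dynamics $f$, has full rank $16$ at every $\bar x$ with $q$ a unit quaternion, $\mu\in\mathbb H$, and $\omega,\beta$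 vector quaternions, and for every control value. 2. The system is locally observable: every state $x_A$ has a neighbourhood $W$ such that for every neighbourhood $V\subset W$ of $x_A$, every $x_B$ that is $V$-indistinguishable from $x_A$ equals $x_A$. Here $x_A,x_B$ are $V$-indistinguishable if for every admissible control $u$ there are $T>0$ and solutions starting at $x_A$ and $x_B$ under $u$ that remain in $V$ and have equal measurements at all times of $[0,T]$. This holds with neighbourhoods and states taken in the state space $\mathbb D_u\times\mathbb D_v$, and also, at every $x_A\in\mathbb D_u\times\mathbb D_v$, with neighbourhoods and points $x_B$ taken in the ambient space $\mathbb D\times\mathbb D\cong\mathbb R^{16}$. -/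

import Mathlib

open scoped Quaternion Topology
open MeasureTheory

noncomputable section

namespace DualQuatObs

/-! ### Quaternions and dual quaternions -/

/-- Dual quaternions `a = a_r + ε a_d` with `a_r, a_d` real quaternions and `ε ^ 2 = 0`;
`a.fst` is the real part, `a.snd` the dual part. -/
abbrev DQ : Type := DualNumber ℍ[ℝ]

/-- The vector quaternion `[0, v]` of a vector `v` in three-space. -/
def vecQuat (v : Fin 3 → ℝ) : ℍ[ℝ] := ⟨0, v 0, v 1, v 2⟩

@[simp] theorem vecQuat_re (v : Fin 3 → ℝ) : (vecQuat v).re = 0 := rfl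
@[simp] theorem vecQuat_imI (v : Fin 3 → ℝ) : (vecQuat v).imI = v 0 := rfl
@[simp] theorem vecQuat_imJ (v : Fin 3 → ℝ) : (vecQuat v).imJ = v 1 := rfl
@[simp] theorem vecQuat_imK (v : Fin 3 → ℝ) : (vecQuat v).imK = v 2 := rfl

/-- Quaternion dot product, a scalar quaternion. -/
def qDot (a b : ℍ[ℝ]) : ℍ[ℝ] :=
  ⟨a.re * b.re + (a.imI * b.imI + a.imJ * b.imJ + a.imK * b.imK), 0, 0, 0⟩

@[simp] theorem qDot_re (a b : ℍ[ℝ]) : (qDot a b).re = 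
    a.re * b.re + (a.imI * b.imI + a.imJ * b.imJ + a.imK * b.imK) := rfl
@[simp] theorem qDot_imI (a b : ℍ[ℝ]) : (qDot a b).imI = 0 := rfl
@[simp] theorem qDot_imJ (a b : ℍ[ℝ]) : (qDot a b).imJ = 0 := rfl
@[simp] theorem qDot_imK (a b : ℍ[ℝ]) : (qDot a b).imK = 0 := rfl

/-- Quaternion cross product `[0, a₀ b⃗ + b₀ a⃗ + a⃗ × b⃗]`. -/
def qCross (a b : ℍ[ℝ]) : ℍ[ℝ] :=
  ⟨0,
   a.re * b.imI + b.re * a.imI + (a.imJ * b.imK - a.imK * b.imJ),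
   a.re * b.imJ + b.re * a.imJ + (a.imK * b.imI - a.imI * b.imK),
   a.re * b.imK + b.re * a.imK + (a.imI * b.imJ - a.imJ * b.imI)⟩

@[simp] theorem qCross_re (a b : ℍ[ℝ]) : (qCross a b).re = 0 := rfl
@[simp] theorem qCross_imI (a b : ℍ[ℝ]) : (qCross a b).imI = 
    a.re * b.imI + b.re * a.imI + (a.imJ * b.imK - a.imK * b.imJ) := rfl
@[simp] theorem qCross_imJ (a b : ℍ[ℝ]) : (qCross a b).imJ = 
    a.re * b.imJ + b.re * a.imJ + (a.imK * b.imI - a.imI * b.imK) := rfl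
@[simp] theorem qCross_imK (a b : ℍ[ℝ]) : (qCross a b).imK = 
    a.re * b.imK + b.re * a.imK + (a.imI * b.imJ - a.imJ * b.imI) := rfl

/-- The dual quaternion `r + ε d`. -/
def mkDQ (r d : ℍ[ℝ]) : DQ := (r, d)

@[simp] theorem mkDQ_fst (r d : ℍ[ℝ]) : (mkDQ r d).fst = r := rfl
@[simp] theorem mkDQ_snd (r d : ℍ[ℝ]) : (mkDQ r d).snd = d := rfl

/-- Dual quaternion conjugate `a_r* + ε a_d*`. -/
def dqConj (a : DQ) : DQ := mkDQ (star a.fst) (star a.snd)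

/-- Dual quaternion dot product. -/
def dqDot (a b : DQ) : DQ :=
  mkDQ (qDot a.fst b.fst) (qDot a.snd b.fst + qDot a.fst b.snd)

/-- Dual quaternion cross product. -/
def dqCross (a b : DQ) : DQ :=
  mkDQ (qCross a.fst b.fst) (qCross a.snd b.fst + qCross a.fst b.snd)

/-- Unit dual quaternions (dual poses). -/
def unitDQ : Set DQ := {a | dqConj a * a = 1 ∧ a * dqConj a = 1 ∧ dqDot a a = 1}

/-- Vector dual quaternions: both parts have zero scalar component. -/
def vectorDQ : Set DQ := {a | a.fst.re = 0 ∧ a.snd.re = 0}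

/-- The dual pose `q + ε ½ r q` of a frame with orientation `q` and position `r`. -/
def dualPose (q r : ℍ[ℝ]) : DQ := mkDQ q ((1 / 2 : ℝ) • (r * q))

/-- The relative position `r = 2 q_d q_r*` encoded in a dual pose. -/
def posOf (a : DQ) : ℍ[ℝ] := (2 : ℝ) • (a.snd * star a.fst)

/-- `posOf` recovers the position from a dual pose. -/
theorem posOf_dualPose (q r : ℍ[ℝ]) (hq : q * star q = 1) : posOf (dualPose q r) = r := by
  simp [posOf, dualPose, mul_assoc, hq]

/-! ### Control systems and local observability -/

section Systems

variable {X Y U : Type*} [NormedAddCommGroup X] [NormedSpace ℝ X]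

/-- `x` is a solution on `[0, T]` of `x' = f (x, u(t))`, `x(0) = x₀`, in integral form
(so that discontinuous controls are allowed). -/
def IsTrajectory (f : X → U → X) (u : ℝ → U) (T : ℝ) (x₀ : X) (x : ℝ → X) : Prop :=
  ContinuousOn x (Set.Icc 0 T) ∧
  IntervalIntegrable (fun s => f (x s) (u s)) volume 0 T ∧
  ∀ t ∈ Set.Icc 0 T, x t = x₀ + ∫ s in (0 : ℝ)..t, f (x s) (u s)

/-- The initial states `a`, `b` are `V`-indistinguishable: for every admissible control, the
state trajectories from `a` and from `b` remain in `V` over some interval `[0, T]`, `T > 0`, and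
produce the same measurement at every time of that interval.
(The horizon may be arbitrarily short and may depend on the control; this is the weakest reading
of indistinguishability, hence the strongest one of observability.) -/
def Indistinguishable (f : X → U → X) (h : X → Y) (𝒰 : Set (ℝ → U)) (V : Set X) (a b : X) : Prop :=
  ∀ u ∈ 𝒰, ∃ T : ℝ, 0 < T ∧ ∃ xa xb : ℝ → X,
    IsTrajectory f u T a xa ∧ IsTrajectory f u T b xb ∧
    (∀ t ∈ Set.Icc 0 T, xa t ∈ V ∧ xb t ∈ V) ∧
    ∀ t ∈ Set.Icc 0 T, h (xa t) = h (xb t)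

/-- Local observability at `a` of the system `x' = f (x, u)`, `y = h x` with state set `S`:
there is a neighbourhood `W` of `a` in `S` such that for every neighbourhood `V ⊆ W` of `a` in
`S`, no state other than `a` is `V`-indistinguishable from `a`. -/
def LocallyObservableAt (f : X → U → X) (h : X → Y) (𝒰 : Set (ℝ → U)) (S : Set X) (a : X) : Prop :=
  ∃ W ⊆ S, W ∈ 𝓝[S] a ∧ ∀ V ⊆ W, V ∈ 𝓝[S] a →
    ∀ b : X, Indistinguishable f h 𝒰 V a b → a = b

/-- Local observability: local observability at all states. -/
def LocallyObservable (f : X → U → X) (h : X → Y) (𝒰 : Set (ℝ → U)) (S : Set X) : Prop :=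
  ∀ a ∈ S, LocallyObservableAt f h 𝒰 S a

/-- First-order Lie derivative `∇g · F` of `g` along the vector field `F`. -/
def lieDeriv {Z : Type*} [NormedAddCommGroup Z] [NormedSpace ℝ Z]
    (F : X → X) (g : X → Z) : X → Z :=
  fun x => fderiv ℝ g x (F x)

end Systems

/-! ### The relative pose and velocity system -/

/-- Ambient sixteen-dimensional space of the pair (dual pose, dual velocity) of the target frame
`T` with respect to the camera frame `C`, in `C` coordinates. -/
abbrev State : Type := DQ × DQ

/-- States: a unit dual quaternion and a vector dual quaternion. -/
def stateSpace : Set State := {x | x.1 ∈ unitDQ ∧ x.2 ∈ vectorDQ}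

/-- The inertial motion entering the relative dynamics, with arbitrary force and torque models:
the dual acceleration of the target (relative to the inertial frame, `T` coordinates), and the
dual velocity and dual acceleration of the camera (relative to the inertial frame, `C`
coordinates), as arbitrary vector dual quaternion functions of the state and of the control. -/
structure InertialMotion (U : Type*) where
  targetAcc : State → U → DQ
  cameraVel : State → U → DQ
  cameraAcc : State → U → DQ
  targetAcc_mem : ∀ x u, targetAcc x u ∈ vectorDQ
  cameraVel_mem : ∀ x u, cameraVel x u ∈ vectorDQ
  cameraAcc_mem : ∀ x u, cameraAcc x u ∈ vectorDQ

/-- The relative pose dynamics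
`q' = ½ ω q`, `ω' = q α_T q* + ω × ω_C - α_C`. -/
def relDynamics {U : Type*} (M : InertialMotion U) (x : State) (u : U) : State :=
  ((1 / 2 : ℝ) • (x.2 * x.1),
   x.1 * M.targetAcc x u * dqConj x.1 + dqCross x.2 (M.cameraVel x u) - M.cameraAcc x u)

/-- Relative position measurements of three markers with positions `p i` in the target frame:
the position of marker `i` relative to the camera, `r + q [0, p i] q*`. -/
def posMeas (p : Fin 3 → Fin 3 → ℝ) (x : State) : Fin 3 → ℍ[ℝ] :=
  fun i => posOf x.1 + x.1.fst * vecQuat (p i) * star x.1.fst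

/-! ### Transformed coordinates and the observability codistribution -/

/-- The transformed state `(q, μ, ω, β)`: real and dual parts of the dual pose and of the dual
velocity. -/
abbrev TState : Type := Fin 4 → ℍ[ℝ]

/-- The state transformation. -/
def toT (x : State) : TState := ![x.1.fst, x.1.snd, x.2.fst, x.2.snd]

/-- The inverse state transformation. -/
def ofT (z : TState) : State := (mkDQ (z 0) (z 1), mkDQ (z 2) (z 3))

theorem toT_ofT (z : TState) : toT (ofT z) = z := by
  funext i; fin_cases i <;> rfl

theorem ofT_toT (x : State) : ofT (toT x) = x := rfl

/-- Transformed states: `q` a unit quaternion, `μ` a quaternion, `ω` and `β` vector quaternions. -/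
def tStateSpace : Set TState := {z | star (z 0) * z 0 = 1 ∧ (z 2).re = 0 ∧ (z 3).re = 0}

/-- The dynamics in transformed coordinates, for a fixed control value. -/
def tDynamics {U : Type*} (M : InertialMotion U) (u : U) (z : TState) : TState :=
  toT (relDynamics M (ofT z) u)

/-- The measurement function in transformed coordinates. -/
def tMeas (p : Fin 3 → Fin 3 → ℝ) (z : TState) : Fin 3 → ℍ[ℝ] := posMeas p (ofT z)

/-- The four real components of a quaternion, scalar component first. -/
def qCoord (a : ℍ[ℝ]) : Fin 4 → ℝ := ![a.re, a.imI, a.imJ, a.imK]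

/-- The basis quaternions `1, i, j, k`. -/
def qBasis : Fin 4 → ℍ[ℝ] := ![⟨1, 0, 0, 0⟩, ⟨0, 1, 0, 0⟩, ⟨0, 0, 1, 0⟩, ⟨0, 0, 0, 1⟩]

/-- The 24 × 16 observability codistribution matrix at the transformed state `z`: the Jacobians of
the Lie derivatives of order `k = 0, 1` of the concatenated measurement function. Rows are indexed
by (order, marker, quaternion component), columns by (block of the transformed state, quaternion
component). -/
def codistribution {U : Type*} (M : InertialMotion U) (p : Fin 3 → Fin 3 → ℝ) (u : U)
    (z : TState) : Matrix (Fin 2 × Fin 3 × Fin 4) (Fin 4 × Fin 4) ℝ :=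
  Matrix.of fun row col =>
    qCoord (fderiv ℝ ((lieDeriv (tDynamics M u))^[(row.1 : ℕ)] (tMeas p)) z
      (Pi.single col.1 (qBasis col.2)) row.2.1) row.2.2

end DualQuatObs

end

open DualQuatObs

/-!
# Observability of the relative pose and velocity from three non-collinear markers

Differences of the marker equations remove the position and leave the vectors `q d q*`, `q e q*`,
for two non-parallel vectors `d`, `e` in the target frame. These two vectors determine the
quaternion `q` up to sign (`eq_or_eq_neg_of_conj_eq`), because only scalars commute with both `d`
and `e`, and determine `δq` exactly (`eq_zero_of_conj_deriv`), because `a d + d a* = 0` and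
`a e + e a* = 0` force `a = 0`. A single marker equation then gives the dual part of the pose.

*Rank.* A direction `(δq, δμ, δω, δβ)` annihilated by the differential of `h` has `δq = 0` and
`δμ = 0`. The Lie derivative of `h` is the differential of `h` applied to the velocity
`½ (ω q, ω μ + β q)`, which is linear in `(ω, β)`, so that the same argument, applied to
`δω q` instead of `δq`, gives `δω = 0` and then `δβ = 0` (`eq_zero_of_fderiv_eq_zero`).
The accelerations do not enter, so they need no regularity.

*Local observability.* On a neighbourhood that separates `q` from `-q`, equal measurements along two
trajectories force equal dual poses at all times (`fst_eq_of_posMeas_eq`), hence equal right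
derivatives `½ ω q` at the initial time (`IsTrajectory.hasDerivWithinAt_fst`), and `q` is
invertible in the dual quaternions. Nothing here uses that the second initial state has
a unit dual pose or a vector dual velocity, so the argument covers the ambient space too.
-/

noncomputable section

namespace DualQuatObs

/-! ### Quaternions acting on two non-parallel vectors -/

/-- A vector of `ℝ³` that is parallel to both `d` and `e` vanishes if `d × e ≠ 0`. -/
theorem eq_zero_of_cross_eq_zero {x y z d₁ d₂ d₃ e₁ e₂ e₃ : ℝ}
    (hd₁ : y * d₃ = z * d₂) (hd₂ : z * d₁ = x * d₃) (hd₃ : x * d₂ = y * d₁)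
    (he₁ : y * e₃ = z * e₂) (he₂ : z * e₁ = x * e₃) (he₃ : x * e₂ = y * e₁)
    (h : ¬ (d₂ * e₃ - d₃ * e₂ = 0 ∧ d₃ * e₁ - d₁ * e₃ = 0 ∧ d₁ * e₂ - d₂ * e₁ = 0)) :
    x = 0 ∧ y = 0 ∧ z = 0 := by
  by_contra hv
  -- Each product of a component of `(x, y, z)` with a component of `d × e` vanishes.
  have key : ∀ t, t = x ∨ t = y ∨ t = z → t * (d₂ * e₃ - d₃ * e₂) = 0 ∧
      t * (d₃ * e₁ - d₁ * e₃) = 0 ∧ t * (d₁ * e₂ - d₂ * e₁) = 0 := by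
    rintro t (rfl | rfl | rfl) <;> refine ⟨?_, ?_, ?_⟩
    · linear_combination e₃ * hd₃ + e₂ * hd₂ + d₁ * he₁
    · linear_combination e₁ * -hd₂ + d₁ * he₂
    · linear_combination e₁ * -hd₃ + d₁ * he₃
    · linear_combination e₂ * -hd₁ + d₂ * he₁
    · linear_combination e₃ * hd₃ + e₁ * hd₁ + d₂ * he₂
    · linear_combination e₂ * -hd₃ + d₂ * he₃
    · linear_combination e₃ * -hd₁ + d₃ * he₁
    · linear_combination e₃ * -hd₂ + d₃ * he₂
    · linear_combination e₂ * hd₂ + e₁ * hd₁ + d₃ * he₃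
  have hz : ∀ t, t = x ∨ t = y ∨ t = z → t = 0 := fun t ht => by
    by_contra h0
    obtain ⟨h1, h2, h3⟩ := key t ht
    exact h ⟨(mul_eq_zero.mp h1).resolve_left h0, (mul_eq_zero.mp h2).resolve_left h0,
      (mul_eq_zero.mp h3).resolve_left h0⟩
  exact hv ⟨hz x (by simp), hz y (by simp), hz z (by simp)⟩

variable {d e : ℍ[ℝ]}

theorem qCross_ne_zero_iff (hd : d.re = 0) (he : e.re = 0) :
    qCross d e ≠ 0 ↔ ¬ (d.imJ * e.imK - d.imK * e.imJ = 0 ∧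
      d.imK * e.imI - d.imI * e.imK = 0 ∧ d.imI * e.imJ - d.imJ * e.imI = 0) := by
  simp [Quaternion.ext_iff, hd, he]

theorem ne_zero_of_qCross_ne_zero (h : qCross d e ≠ 0) : d ≠ 0 := by
  rintro rfl
  exact h (by ext <;> simp)

/-- The commutant of two non-parallel vector quaternions consists of the scalars. -/
theorem im_eq_zero_of_commute (hd : d.re = 0) (he : e.re = 0) (h : qCross d e ≠ 0) {c : ℍ[ℝ]}
    (hcd : c * d = d * c) (hce : c * e = e * c) : c.im = 0 := by
  have h1 := (Quaternion.ext_iff.mp hcd)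
  have h2 := (Quaternion.ext_iff.mp hce)
  simp only [Quaternion.re_mul, Quaternion.imI_mul, Quaternion.imJ_mul, Quaternion.imK_mul,
    hd, he] at h1 h2
  obtain ⟨-, a1, a2, a3⟩ := h1
  obtain ⟨-, b1, b2, b3⟩ := h2
  obtain ⟨x, y, z⟩ := eq_zero_of_cross_eq_zero (x := c.imI) (y := c.imJ) (z := c.imK)
    (by linarith) (by linarith) (by linarith) (by linarith) (by linarith) (by linarith)
    ((qCross_ne_zero_iff hd he).mp h)
  ext <;> simp [x, y, z]

/-- The infinitesimal rotations and scalings `d ↦ a d + d a*` are determined by their values at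
two non-parallel vectors. -/
theorem eq_zero_of_mul_add_mul_star (hd : d.re = 0) (he : e.re = 0) (h : qCross d e ≠ 0)
    {a : ℍ[ℝ]} (had : a * d + d * star a = 0) (hae : a * e + e * star a = 0) : a = 0 := by
  have h1 := Quaternion.ext_iff.mp had
  have h2 := Quaternion.ext_iff.mp hae
  simp only [Quaternion.re_mul, Quaternion.imI_mul, Quaternion.imJ_mul, Quaternion.imK_mul,
    Quaternion.re_add, Quaternion.imI_add, Quaternion.imJ_add, Quaternion.imK_add,
    Quaternion.re_star, Quaternion.imI_star, Quaternion.imJ_star, Quaternion.imK_star,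
    Quaternion.re_zero, Quaternion.imI_zero, Quaternion.imJ_zero, Quaternion.imK_zero,
    hd, he] at h1 h2
  obtain ⟨-, a1, a2, a3⟩ := h1
  obtain ⟨-, b1, b2, b3⟩ := h2
  -- The inner product of `2 a₀ d + 2 a × d = 0` with `d`.
  have hre : a.re * (d.imI ^ 2 + d.imJ ^ 2 + d.imK ^ 2) = 0 := by
    linear_combination (d.imI * a1 + d.imJ * a2 + d.imK * a3) / 2
  have hd0 : d.imI ^ 2 + d.imJ ^ 2 + d.imK ^ 2 ≠ 0 := by
    intro h0
    refine ne_zero_of_qCross_ne_zero h (Quaternion.normSq_eq_zero.mp ?_)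
    rw [Quaternion.normSq_def', hd]
    linarith
  have ha0 := (mul_eq_zero.mp hre).resolve_right hd0
  rw [ha0] at a1 a2 a3 b1 b2 b3
  obtain ⟨x, y, z⟩ := eq_zero_of_cross_eq_zero (x := a.imI) (y := a.imJ) (z := a.imK)
    (by linarith) (by linarith) (by linarith) (by linarith) (by linarith) (by linarith)
    ((qCross_ne_zero_iff hd he).mp h)
  ext <;> simp [ha0, x, y, z]

/-- The derivative at a unit quaternion `q` of the map that sends `q` to the pair of vectors
`q d q*`, `q e q*` is injective. -/
theorem eq_zero_of_conj_deriv (hd : d.re = 0) (he : e.re = 0) (h : qCross d e ≠ 0) {q w : ℍ[ℝ]}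
    (hq : star q * q = 1) (hwd : w * d * star q + q * d * star w = 0)
    (hwe : w * e * star q + q * e * star w = 0) : w = 0 := by
  have hq' : q * star q = 1 := mul_eq_one_comm.mp hq
  have pull : ∀ c : ℍ[ℝ], w * c * star q + q * c * star w = 0 →
      star q * w * c + c * star (star q * w) = 0 := fun c hc => by
    calc star q * w * c + c * star (star q * w)
        = star q * w * c * (star q * q) + (star q * q) * c * star (star q * w) := by simp [hq]
      _ = star q * (w * c * star q + q * c * star w) * q := by
        rw [star_mul, star_star]; noncomm_ring
      _ = 0 := by simp [hc]
  have h0 := eq_zero_of_mul_add_mul_star hd he h (pull d hwd) (pull e hwe)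
  calc w = q * (star q * w) := by rw [← mul_assoc, hq', one_mul]
    _ = 0 := by rw [h0, mul_zero]

/-- Two quaternions with the same action on two non-parallel vectors agree up to sign. -/
theorem eq_or_eq_neg_of_conj_eq (hd : d.re = 0) (he : e.re = 0) (h : qCross d e ≠ 0)
    {q r : ℍ[ℝ]} (hqd : q * d * star q = r * d * star r) (hqe : q * e * star q = r * e * star r) :
    q = r ∨ q = -r := by
  have hd0 := ne_zero_of_qCross_ne_zero h
  have hN : Quaternion.normSq q = Quaternion.normSq r := by
    have := congrArg Quaternion.normSq hqd
    simp only [map_mul, Quaternion.normSq_star] at this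
    have hdn : Quaternion.normSq d ≠ 0 := by simpa using hd0
    have h2 : Quaternion.normSq q ^ 2 = Quaternion.normSq r ^ 2 := by
      apply mul_right_cancel₀ hdn
      linear_combination this
    exact (pow_left_inj₀ Quaternion.normSq_nonneg Quaternion.normSq_nonneg two_ne_zero).mp h2
  set N := Quaternion.normSq q
  by_cases hN0 : N = 0
  · left
    rw [Quaternion.normSq_eq_zero.mp (show Quaternion.normSq q = 0 from hN0),
      Quaternion.normSq_eq_zero.mp (hN.symm.trans hN0)]
  have hsq : star q * q = (N : ℍ[ℝ]) := Quaternion.star_mul_self q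
  have hqs : q * star q = (N : ℍ[ℝ]) := Quaternion.self_mul_star q
  have hsr : star r * r = (N : ℍ[ℝ]) := by rw [Quaternion.star_mul_self, hN]
  have hcomm : ∀ c : ℍ[ℝ], q * c * star q = r * c * star r →
      star q * r * c = c * (star q * r) := fun c hc => by
    have h1 : (N : ℍ[ℝ]) * (star q * r * c) = (N : ℍ[ℝ]) * (c * (star q * r)) := by
      calc (N : ℍ[ℝ]) * (star q * r * c) = star q * r * c * (star r * r) := by
            rw [hsr, Quaternion.coe_commutes]
        _ = star q * (r * c * star r) * r := by noncomm_ring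
        _ = (star q * q) * c * (star q * r) := by rw [← hc]; noncomm_ring
        _ = _ := by rw [hsq, mul_assoc]
    exact mul_left_cancel₀ (fun h0 => hN0 (Quaternion.coe_injective h0)) h1
  have him := im_eq_zero_of_commute hd he h (hcomm d hqd) (hcomm e hqe)
  -- `q* r` is a real number of square `N ^ 2`.
  obtain ⟨s, hs⟩ : ∃ s : ℝ, star q * r = (s : ℍ[ℝ]) :=
    ⟨(star q * r).re, by conv_lhs => rw [← Quaternion.re_add_im (star q * r), him, add_zero]⟩
  have hss : s ^ 2 = N ^ 2 := by
    have := congrArg Quaternion.normSq hs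
    rw [map_mul, Quaternion.normSq_star, Quaternion.normSq_coe, ← hN] at this
    linear_combination -this
  have hr : N • r = s • q := by
    calc N • r = q * (star q * r) := by
          rw [← mul_assoc, hqs, Quaternion.coe_mul_eq_smul]
      _ = s • q := by rw [hs, Quaternion.mul_coe_eq_smul]
  rcases sq_eq_sq_iff_eq_or_eq_neg.mp hss with rfl | rfl
  · exact Or.inl (smul_right_injective _ hN0 hr.symm)
  · refine Or.inr (smul_right_injective _ hN0 ?_)
    simp only [smul_neg, hr, neg_smul, neg_neg]

/-! ### Rank of the observability codistribution -/

section Rank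

variable {U : Type*} (M : InertialMotion U) (p : Fin 3 → Fin 3 → ℝ) (u : U)

theorem tMeas_apply (z : TState) (i : Fin 3) :
    tMeas p z i = (2 : ℝ) • (z 1 * star (z 0)) + z 0 * vecQuat (p i) * star (z 0) := rfl

theorem tDynamics_zero (z : TState) : tDynamics M u z 0 = (1 / 2 : ℝ) • (z 2 * z 0) := rfl

theorem tDynamics_one (z : TState) :
    tDynamics M u z 1 = (1 / 2 : ℝ) • (z 2 * z 1 + z 3 * z 0) := rfl

instance starModuleQuaternion : StarModule ℝ ℍ[ℝ] := ⟨fun r a => by ext <;> simp⟩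

/-- The derivative of the expression `2 m s* + r c s*`, for maps `m`, `r`, `s` into the
quaternions. The measurement and its Lie derivative are sums of such expressions. -/
theorem exists_hasFDerivAt_marker {E : Type*} [NormedAddCommGroup E] [NormedSpace ℝ E]
    {m r s : E → ℍ[ℝ]} {m' r' s' : E →L[ℝ] ℍ[ℝ]} {x : E} (c : ℍ[ℝ]) (hm : HasFDerivAt m m' x)
    (hr : HasFDerivAt r r' x) (hs : HasFDerivAt s s' x) :
    ∃ L : E →L[ℝ] ℍ[ℝ],
      HasFDerivAt (fun y => (2 : ℝ) • (m y * star (s y)) + r y * c * star (s y)) L x ∧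
      ∀ v, L v = (2 : ℝ) • (m' v * star (s x) + m x * star (s' v)) +
        (r' v * c * star (s x) + r x * c * star (s' v)) := by
  refine ⟨_, ((hm.mul' hs.star).const_smul (2 : ℝ)).add
    ((hr.mul' (hasFDerivAt_const c x)).mul' hs.star), fun v => ?_⟩
  simp only [add_apply, smul_apply, ContinuousLinearMap.comp_apply,
    ContinuousLinearEquiv.coe_coe, starL'_apply, zero_apply, smul_eq_mul,
    MulOpposite.smul_eq_mul_unop, MulOpposite.unop_op, Pi.mul_apply, mul_zero, zero_add]
  rw [add_comm (m x * _), add_comm (r x * c * _)]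

theorem hasFDerivAt_coord (j : Fin 4) (z : TState) :
    HasFDerivAt (fun y : TState => y j) (ContinuousLinearMap.proj (R := ℝ) j) z :=
  (ContinuousLinearMap.proj (R := ℝ) (φ := fun _ : Fin 4 => ℍ[ℝ]) j).hasFDerivAt

theorem fderiv_tMeas_apply (z v : TState) (i : Fin 3) :
    fderiv ℝ (tMeas p) z v i = (2 : ℝ) • (v 1 * star (z 0) + z 1 * star (v 0)) +
      (v 0 * vecQuat (p i) * star (z 0) + z 0 * vecQuat (p i) * star (v 0)) := by
  choose L hL hv using fun i => exists_hasFDerivAt_marker (vecQuat (p i))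
    (hasFDerivAt_coord 1 z) (hasFDerivAt_coord 0 z) (hasFDerivAt_coord 0 z)
  have : HasFDerivAt (tMeas p) (ContinuousLinearMap.pi L) z := hasFDerivAt_pi.mpr hL
  rw [this.fderiv]
  exact hv i v

/-- The first-order Lie derivative of the measurement involves only the kinematics, so it does not
depend on the accelerations. -/
theorem lieDeriv_tMeas :
    lieDeriv (tDynamics M u) (tMeas p) = fun z i =>
      ((2 : ℝ) • ((1 / 2 : ℝ) • (z 2 * z 1 + z 3 * z 0) * star (z 0)) +
        (1 / 2 : ℝ) • (z 2 * z 0) * vecQuat (p i) * star (z 0)) +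
      ((2 : ℝ) • (z 1 * star ((1 / 2 : ℝ) • (z 2 * z 0))) +
        z 0 * vecQuat (p i) * star ((1 / 2 : ℝ) • (z 2 * z 0))) := by
  funext z i
  rw [lieDeriv, fderiv_tMeas_apply, tDynamics_zero, tDynamics_one, smul_add]
  abel

/-- The derivative of the first-order Lie derivative in the directions that fix `q` and `μ`. -/
theorem fderiv_lieDeriv_tMeas_apply (z v : TState) (h0 : v 0 = 0) (h1 : v 1 = 0) (i : Fin 3) :
    fderiv ℝ (lieDeriv (tDynamics M u) (tMeas p)) z v i =
      ((v 2 * z 1 + v 3 * z 0) * star (z 0) + z 1 * star (v 2 * z 0)) +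
      (1 / 2 : ℝ) • (v 2 * z 0 * vecQuat (p i) * star (z 0) +
        z 0 * vecQuat (p i) * star (v 2 * z 0)) := by
  have hq := ((hasFDerivAt_coord 2 z).mul' (hasFDerivAt_coord 0 z)).const_smul (1 / 2 : ℝ)
  have hm := (((hasFDerivAt_coord 2 z).mul' (hasFDerivAt_coord 1 z)).add
    ((hasFDerivAt_coord 3 z).mul' (hasFDerivAt_coord 0 z))).const_smul (1 / 2 : ℝ)
  choose A hA eA using fun i =>
    exists_hasFDerivAt_marker (vecQuat (p i)) hm hq (hasFDerivAt_coord 0 z)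
  choose B hB eB using fun i => exists_hasFDerivAt_marker (vecQuat (p i))
    (hasFDerivAt_coord 1 z) (hasFDerivAt_coord 0 z) hq
  have key : HasFDerivAt (lieDeriv (tDynamics M u) (tMeas p))
      (ContinuousLinearMap.pi fun i => A i + B i) z := by
    rw [lieDeriv_tMeas]
    exact hasFDerivAt_pi.mpr fun i => (hA i).add (hB i)
  rw [key.fderiv]
  simp [eA, eB, h0, h1, smul_add, smul_smul, add_mul, add_assoc, add_left_comm]

variable {p} in
/-- Infinitesimal observability: a direction annihilated by the differentials of the measurement
and of its first Lie derivative vanishes. The differential of the measurement determines `q` and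
`μ`, then that of the Lie derivative determines `ω` and `β`. In both cases the differences between
markers come first. -/
theorem eq_zero_of_fderiv_eq_zero
    (hp : qCross (vecQuat (p 1) - vecQuat (p 0)) (vecQuat (p 2) - vecQuat (p 0)) ≠ 0)
    {z : TState} (hz : star (z 0) * z 0 = 1) {v : TState}
    (h0 : fderiv ℝ (tMeas p) z v = 0)
    (h1 : fderiv ℝ (lieDeriv (tDynamics M u) (tMeas p)) z v = 0) : v = 0 := by
  have hne : z 0 ≠ 0 := right_ne_zero_of_mul_eq_one hz
  -- Subtraction of the equations of two markers removes the terms common to all markers.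
  have diff : ∀ (w a : ℍ[ℝ]) (k : ℝ), k ≠ 0 →
      (∀ i, a + k • (w * vecQuat (p i) * star (z 0) + z 0 * vecQuat (p i) * star w) = 0) →
      w = 0 := fun w a k hk h => by
    have sub : ∀ i, w * (vecQuat (p i) - vecQuat (p 0)) * star (z 0) +
        z 0 * (vecQuat (p i) - vecQuat (p 0)) * star w = 0 := fun i => by
      have := smul_right_injective _ hk (add_left_cancel ((h i).trans (h 0).symm))
      rw [← sub_eq_zero] at this
      rw [← this]
      noncomm_ring
    exact eq_zero_of_conj_deriv (by simp) (by simp) hp hz (sub 1) (sub 2)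
  have e0 := fun i => (fderiv_tMeas_apply p z v i).symm.trans (congrFun h0 i)
  have hv0 : v 0 = 0 := diff _ _ 1 one_ne_zero fun i => by rw [one_smul]; exact e0 i
  have hv1 : v 1 = 0 := by simpa [hv0, hne] using e0 0
  have e1 := fun i =>
    (fderiv_lieDeriv_tMeas_apply M p u z v hv0 hv1 i).symm.trans (congrFun h1 i)
  have hv2 : v 2 = 0 := by
    simpa [hne] using diff _ _ (1 / 2) (by norm_num) e1
  have hv3 : v 3 = 0 := by simpa [hv2, hne] using e1 0
  funext j
  fin_cases j <;> assumption

/-- A component of a quaternion, as a linear functional. -/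
def qCoordLinear (k : Fin 4) : ℍ[ℝ] →ₗ[ℝ] ℝ where
  toFun a := qCoord a k
  map_add' a b := by fin_cases k <;> simp [qCoord]
  map_smul' r a := by fin_cases k <;> simp [qCoord]

theorem qCoord_injective : Function.Injective qCoord := fun a b h => by
  ext
  · exact congrFun h 0
  · exact congrFun h 1
  · exact congrFun h 2
  · exact congrFun h 3

/-- The tangent vector with the given components. -/
def tangentVec (w : Fin 4 × Fin 4 → ℝ) : TState :=
  ∑ c, w c • Pi.single c.1 (qBasis c.2)

theorem qCoord_tangentVec (w : Fin 4 × Fin 4 → ℝ) (j k : Fin 4) :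
    qCoord (tangentVec w j) k = w (j, k) := by
  have hb : ∀ k l, qCoord (qBasis l) k = if l = k then 1 else 0 := by
    intro k l
    fin_cases k <;> fin_cases l <;> simp [qCoord, qBasis]
  change qCoordLinear k (tangentVec w j) = _
  have hs : ∀ c : Fin 4 × Fin 4,
      qCoordLinear k ((w c • (Pi.single c.1 (qBasis c.2) : TState)) j) =
        if c = (j, k) then w c else 0 := by
    rintro ⟨a, b⟩
    rw [Pi.smul_apply, map_smul]
    by_cases ha : a = j
    · subst ha
      rw [Pi.single_eq_same]
      change _ • qCoord (qBasis b) k = _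
      simp [hb]
    · simp [ha]
  rw [tangentVec, Finset.sum_apply, map_sum, Finset.sum_congr rfl fun c _ => hs c]
  simp

/-- The codistribution matrix acts on component vectors as the differentials of the Lie derivatives
act on tangent vectors. -/
theorem codistribution_mulVec (z : TState) (w : Fin 4 × Fin 4 → ℝ)
    (row : Fin 2 × Fin 3 × Fin 4) :
    (codistribution M p u z).mulVec w row =
      qCoord (fderiv ℝ ((lieDeriv (tDynamics M u))^[(row.1 : ℕ)] (tMeas p)) z
        (tangentVec w) row.2.1) row.2.2 := by
  let D : TState →ₗ[ℝ] ℝ := qCoordLinear row.2.2 ∘ₗ LinearMap.proj row.2.1 ∘ₗ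
    (fderiv ℝ ((lieDeriv (tDynamics M u))^[(row.1 : ℕ)] (tMeas p)) z).toLinearMap
  change ∑ c, codistribution M p u z row c * w c = D (tangentVec w)
  rw [tangentVec, map_sum]
  refine Finset.sum_congr rfl fun c _ => ?_
  rw [map_smul, smul_eq_mul, mul_comm]
  rfl

variable {p} in
theorem rank_codistribution
    (hp : qCross (vecQuat (p 1) - vecQuat (p 0)) (vecQuat (p 2) - vecQuat (p 0)) ≠ 0)
    {z : TState} (hz : star (z 0) * z 0 = 1) : (codistribution M p u z).rank = 16 := by
  have hinj : Function.Injective (codistribution M p u z).mulVecLin := by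
    refine (injective_iff_map_eq_zero _).mpr fun w hw => ?_
    have hrow : ∀ n : Fin 2,
        fderiv ℝ ((lieDeriv (tDynamics M u))^[(n : ℕ)] (tMeas p)) z (tangentVec w) = 0 := by
      intro n
      funext i
      refine qCoord_injective (funext fun k => ?_)
      rw [← codistribution_mulVec M p u z w (n, i, k)]
      refine (congrFun hw (n, i, k)).trans ?_
      fin_cases k <;> rfl
    have h := eq_zero_of_fderiv_eq_zero M u hp hz (hrow 0) (hrow 1)
    funext ⟨j, k⟩
    rw [← qCoord_tangentVec w j k, h]
    fin_cases k <;> rfl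
  rw [Matrix.rank, LinearMap.finrank_range_of_inj hinj]
  simp

end Rank

/-! ### Local observability -/

section Observability

variable {U : Type*} {M : InertialMotion U} {p : Fin 3 → Fin 3 → ℝ}

/-- Along a trajectory the dual pose has right derivative `½ ω q` at the initial time, although
the control may be discontinuous. -/
theorem IsTrajectory.hasDerivWithinAt_fst {u : ℝ → U} {T : ℝ} (hT : 0 < T) {a : State}
    {x : ℝ → State} (hx : IsTrajectory (relDynamics M) u T a x) :
    HasDerivWithinAt (fun t => (x t).1) ((1 / 2 : ℝ) • (a.2 * a.1)) (Set.Icc 0 T) 0 := by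
  obtain ⟨hc, hi, he⟩ := hx
  have h0 : (0 : ℝ) ∈ Set.Icc 0 T := ⟨le_rfl, hT.le⟩
  have hx0 : x 0 = a := by simpa using he 0 h0
  have hg : ContinuousOn (fun s => (1 / 2 : ℝ) • ((x s).2 * (x s).1)) (Set.Icc 0 T) :=
    (hc.snd.mul hc.fst).const_smul (1 / 2 : ℝ)
  have hnhds : Set.Icc 0 T ∈ 𝓝[>] (0 : ℝ) := Icc_mem_nhdsGT hT
  have hmeas : StronglyMeasurableAtFilter (fun s => (1 / 2 : ℝ) • ((x s).2 * (x s).1))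
      (𝓝[>] (0 : ℝ)) :=
    ⟨_, hnhds, hg.aestronglyMeasurable measurableSet_Icc⟩
  have hcont : ContinuousWithinAt (fun s => (1 / 2 : ℝ) • ((x s).2 * (x s).1)) (Set.Ioi 0) 0 :=
    (hg 0 h0).mono_of_mem_nhdsWithin hnhds
  have hd : HasDerivWithinAt
      (fun t => ∫ s in (0 : ℝ)..t, (1 / 2 : ℝ) • ((x s).2 * (x s).1))
      ((1 / 2 : ℝ) • ((x 0).2 * (x 0).1)) (Set.Ici 0) 0 :=
    intervalIntegral.integral_hasDerivWithinAt_right (by simp) hmeas hcont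
  rw [hx0] at hd
  have heq : ∀ t ∈ Set.Icc 0 T,
      (x t).1 = a.1 + ∫ s in (0 : ℝ)..t, (1 / 2 : ℝ) • ((x s).2 * (x s).1) := fun t ht => by
    have hit : IntervalIntegrable (fun s => relDynamics M (x s) (u s)) volume 0 t :=
      hi.mono_set (by
        rw [Set.uIcc_of_le hT.le, Set.uIcc_of_le ht.1]
        exact Set.Icc_subset_Icc_right ht.2)
    have := (ContinuousLinearMap.fst ℝ DQ DQ).intervalIntegral_comp_comm hit
    rw [he t ht, Prod.fst_add]
    exact congrArg (a.1 + ·) this.symm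
  exact ((hd.mono Set.Icc_subset_Ici_self).const_add a.1).congr heq (heq 0 h0)

/-- Equal measurements of three non-collinear markers give equal dual poses, if the orientation
quaternions lie in a common open half space. -/
theorem fst_eq_of_posMeas_eq
    (hp : qCross (vecQuat (p 1) - vecQuat (p 0)) (vecQuat (p 2) - vecQuat (p 0)) ≠ 0)
    {x y : State} {c : ℍ[ℝ]} (hx : 0 < (x.1.fst * c).re) (hy : 0 < (y.1.fst * c).re)
    (h : posMeas p x = posMeas p y) : x.1 = y.1 := by
  have hi : ∀ i, posOf x.1 + x.1.fst * vecQuat (p i) * star x.1.fst =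
    posOf y.1 + y.1.fst * vecQuat (p i) * star y.1.fst := congrFun h
  have sub : ∀ i, x.1.fst * (vecQuat (p i) - vecQuat (p 0)) * star x.1.fst =
      y.1.fst * (vecQuat (p i) - vecQuat (p 0)) * star y.1.fst := fun i => by
    have := congrArg₂ (· - ·) (hi i) (hi 0)
    simpa only [add_sub_add_left_eq_sub, ← mul_sub, ← sub_mul] using this
  have hq : x.1.fst = y.1.fst := by
    refine (eq_or_eq_neg_of_conj_eq (by simp) (by simp) hp (sub 1) (sub 2)).resolve_right ?_
    intro hneg
    rw [hneg, neg_mul, Quaternion.re_neg] at hx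
    linarith
  have hne : y.1.fst ≠ 0 := by
    intro h0
    simp [h0] at hy
  have hpos := hi 0
  rw [hq, add_left_inj, posOf, posOf, hq] at hpos
  have hm := smul_right_injective _ (two_ne_zero (α := ℝ)) hpos
  exact TrivSqZeroExt.ext hq (mul_right_cancel₀ (star_ne_zero.mpr hne) hm)

/-- Local observability with respect to any set of states, in particular with perturbations of the
initial state that leave the state space. -/
theorem locallyObservableAt {𝒰 : Set (ℝ → U)} (h𝒰 : 𝒰.Nonempty)
    (hp : qCross (vecQuat (p 1) - vecQuat (p 0)) (vecQuat (p 2) - vecQuat (p 0)) ≠ 0)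
    (S : Set State) {a : State} (ha : a.1 ∈ unitDQ) :
    LocallyObservableAt (relDynamics M) (posMeas p) 𝒰 S a := by
  -- The neighbourhood separates an orientation quaternion `q` from `-q`.
  set O : Set State := {x | 0 < (x.1.fst * star a.1.fst).re} with hO
  have hopen : IsOpen O := by
    refine isOpen_lt continuous_const (Quaternion.continuous_re.comp (Continuous.mul ?_ ?_))
    · exact TrivSqZeroExt.continuous_fst.comp continuous_fst
    · exact continuous_const
  have haO : a ∈ O := by
    have h1 : a.1.fst * star a.1.fst = 1 := congrArg TrivSqZeroExt.fst ha.2.1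
    change 0 < (a.1.fst * star a.1.fst).re
    rw [h1]
    exact one_pos
  refine ⟨S ∩ O, Set.inter_subset_left,
    Filter.inter_mem self_mem_nhdsWithin (mem_nhdsWithin_of_mem_nhds (hopen.mem_nhds haO)), ?_⟩
  intro V hV _ b hind
  obtain ⟨u, hu⟩ := h𝒰
  obtain ⟨T, hT, xa, xb, hxa, hxb, hmem, hmeas⟩ := hind u hu
  have h0 : (0 : ℝ) ∈ Set.Icc 0 T := ⟨le_rfl, hT.le⟩
  have hfst : ∀ t ∈ Set.Icc 0 T, (xa t).1 = (xb t).1 := fun t ht =>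
    fst_eq_of_posMeas_eq hp (hV (hmem t ht).1).2 (hV (hmem t ht).2).2 (hmeas t ht)
  have hab1 : a.1 = b.1 := by
    have ea : xa 0 = a := by simpa using hxa.2.2 0 h0
    have eb : xb 0 = b := by simpa using hxb.2.2 0 h0
    simpa [ea, eb] using hfst 0 h0
  have hder : (1 / 2 : ℝ) • (a.2 * a.1) = (1 / 2 : ℝ) • (b.2 * b.1) :=
    (uniqueDiffOn_Icc hT 0 h0).eq_deriv _ (hxa.hasDerivWithinAt_fst hT)
      ((hxb.hasDerivWithinAt_fst hT).congr hfst (hfst 0 h0))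
  have hmul : a.2 * a.1 = b.2 * a.1 := by
    have := congrArg ((2 : ℝ) • ·) hder
    simpa [smul_smul, ← hab1] using this
  refine Prod.ext hab1 ?_
  calc a.2 = a.2 * a.1 * dqConj a.1 := by rw [mul_assoc, ha.2.1, mul_one]
    _ = b.2 := by rw [hmul, mul_assoc, ha.2.1, mul_one]

end Observability

end DualQuatObs

end

open DualQuatObs
theorem theorem2 {U : Type*} (M : InertialMotion U) (𝒰 : Set (ℝ → U)) (h𝒰 : 𝒰.Nonempty)
    (p : Fin 3 → Fin 3 → ℝ)
    (hp : qCross (vecQuat (p 1) - vecQuat (p 0)) (vecQuat (p 2) - vecQuat (p 0)) ≠ 0) :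
    (∀ z ∈ tStateSpace, ∀ u : U, (codistribution M p u z).rank = 16) ∧
    LocallyObservable (relDynamics M) (posMeas p) 𝒰 stateSpace ∧
    (∀ x ∈ stateSpace, LocallyObservableAt (relDynamics M) (posMeas p) 𝒰 Set.univ x) :=
  ⟨fun _ hz u => rank_codistribution M u hp hz.1,
    fun _ hx => locallyObservableAt h𝒰 hp _ hx.1,
    fun _ hx => locallyObservableAt h𝒰 hp _ hx.1⟩
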